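/- Let $r\ge 1$ and $n=2r$. For $\sigma\in\mathbb S_n$ let $\mathbf m_\sigma^r=(\mathbf m_\sigma^r(1),\dots,\mathbf m_\sigma^r(n))\in\{1,2\}^n$ be the binary multipermutation given by $\mathbf m_\sigma^r(i)=j$ iff $(j-1)r+1\le\sigma(i)\le jr$, and let $\mathcal M_r(\mathbb S_n)=\{\mathbf m_\sigma^r:\sigma\in\mathbb S_n\}$. For permutations let $\mathrm d_\circ(\sigma,\pi)=n-\ell(\sigma,\pi)$, where $\ell(\sigma,\pi)$ is the length of a longest common subsequence of $(\sigma(1),\dots,\sigma(n))$ and $(\pi(1),\dots,\pi(n))$. For multipermutations let $\mathrm d_\circ(\mathbf m_\sigma^r,\mathbf m_\pi^r)$ be the minimum of $\mathrm d_\circ(\sigma',\pi')$ over all $\sigma',\pi'\in\mathbb S_n$ with $\mathbf m_{\sigma'}^r=\mathbf m_\sigma^r$ and $\mathbf m_{\pi'}^r=\mathbf m_\pi^r$. Let $S(\mathbf m,t)=\{\mathbf m'\in\mathcal M_r(\mathbb S_n):\mathrm d_\circ(\mathbf m,\mathbf m')\le t\}$ and $$U(r)=1+(n-1)^2-\left((\sqrt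 r-1)(r-1)+(n-1)(r-1)+(\sqrt r-1)\left(\Big(\frac{r}{\sqrt r+1}-1\Big)^2-\frac14\right)\right).$$ Then the following hold. 1. For every $\sigma\in\mathbb S_n$, $|S(\mathbf m_\sigma^r,1)|\le U(r)$, and the inequality is strict if $r\ge2$. 2. If $C\subseteq\mathcal M_r(\mathbb S_n)$ is a perfect single-error correcting code, that is, every $\mathbf m\in\mathcal M_r(\mathbb S_n)$ lies in $S(\mathbf c,1)$ for exactly one $\mathbf c\in C$, then $$\frac{n!}{(r!)^2\,U(r)}\le|C|.$$ 3. Let $d$ be a positive integer, and let $C\subseteq\mathcal M_r(\mathbb S_n)$ be a code whose minimum distance $\min\{\mathrm d_\circ(\mathbf x,\mathbf y):\mathbf x,\mathbf y\in C,\ \mathbf x\ne\mathbf y\}$ is $d$, and whose cardinality is maximal among all subsets of $\mathcal M_r(\mathbb S_n)$ with minimum distance $d$. Then $$\frac{n!}{(r!)^2\,U(r)^{d-1}}\le|C|.$$ -/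

import Mathlib

namespace UlamCode

/-- `ℓ(x, y)`: the length of a longest common subsequence of `x` and `y`. The positions `i` in `x`
and `j` in `y` of a common subsequence of length `k` are strictly increasing `k`-tuples. -/
noncomputable def lcsLength {n : ℕ} {α : Type*} (x y : Fin n → α) : ℕ :=
  sSup {k : ℕ | ∃ i j : Fin k → Fin n, StrictMono i ∧ StrictMono j ∧ ∀ l, x (i l) = y (j l)}

/-- The Ulam distance `n - ℓ(σ, π)` of two permutations. The subtraction does not truncate,
because `ℓ(σ, π) ≤ n`. -/
noncomputable def permDist {n : ℕ} (σ π : Equiv.Perm (Fin n)) : ℕ :=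
  n - lcsLength σ π

/-- The `r`-regular multipermutation of `σ`, a tuple with entries in `{1, …, n / r}`. Since `Fin n`
is `{0, …, n - 1}`, the number written `σ(i) ∈ {1, …, n}` is `(σ i : ℕ) + 1` here. -/
def multiperm {n : ℕ} (r : ℕ) (σ : Equiv.Perm (Fin n)) : Fin n → ℕ :=
  fun i => (σ i : ℕ) / r + 1

/-- The entry of the multipermutation at `i` is the `j` with `(j - 1) r + 1 ≤ σ(i) ≤ j r`. -/
theorem multiperm_eq_iff {n r : ℕ} (hr : 0 < r) (σ : Equiv.Perm (Fin n)) (i : Fin n) (j : ℕ)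
    (hj : 1 ≤ j) :
    multiperm r σ i = j ↔ (j - 1) * r + 1 ≤ (σ i : ℕ) + 1 ∧ (σ i : ℕ) + 1 ≤ j * r := by
  obtain ⟨k, rfl⟩ : ∃ k, j = k + 1 := ⟨j - 1, by omega⟩
  simp only [multiperm, Nat.add_right_cancel_iff, Nat.add_sub_cancel]
  rw [Nat.div_eq_iff hr, Nat.succ_mul]
  omega

/-- `M_r(S_n)`: the set of all `r`-regular multipermutations of length `n`. -/
def multiperms (n r : ℕ) : Set (Fin n → ℕ) :=
  Set.range (multiperm (n := n) r)

/-- The `r`-regular Ulam distance of two multipermutations: the minimum of the Ulam distances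
between the permutations that represent them. -/
noncomputable def ulamDist {n : ℕ} (r : ℕ) (x y : Fin n → ℕ) : ℕ :=
  sInf {k : ℕ | ∃ σ π : Equiv.Perm (Fin n),
    multiperm r σ = x ∧ multiperm r π = y ∧ permDist σ π = k}

/-- The `r`-regular Ulam sphere with center `x` and radius `t`. -/
def sphere {n : ℕ} (r : ℕ) (x : Fin n → ℕ) (t : ℕ) : Set (Fin n → ℕ) :=
  {y | y ∈ multiperms n r ∧ ulamDist r x y ≤ t}

/-- A multipermutation code `MPC(n, r)`. -/
def IsMPC {n : ℕ} (r : ℕ) (C : Set (Fin n → ℕ)) : Prop :=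
  C ⊆ multiperms n r

/-- A multipermutation code `MPC(n, r, d)`: the minimum Ulam distance of two distinct codewords
is `d`. -/
def IsMPCDist {n : ℕ} (r d : ℕ) (C : Set (Fin n → ℕ)) : Prop :=
  IsMPC r C ∧ IsLeast {k : ℕ | ∃ x ∈ C, ∃ y ∈ C, x ≠ y ∧ ulamDist r x y = k} d

/-- A perfect `t`-error correcting `MPC(n, r)`. -/
def IsPerfect {n : ℕ} (r t : ℕ) (C : Set (Fin n → ℕ)) : Prop :=
  IsMPC r C ∧ ∀ x ∈ multiperms n r, ∃! c, c ∈ C ∧ x ∈ sphere r c t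

/-- The bound `U(r)`, where `n = 2 r`. -/
noncomputable def sphereBound (r : ℕ) : ℝ :=
  let n : ℝ := 2 * (r : ℝ)
  let c : ℝ := Real.sqrt r
  1 + (n - 1) ^ 2 -
    ((c - 1) * (r - 1) + (n - 1) * (r - 1) + (c - 1) * ((r / (c + 1) - 1) ^ 2 - 1 / 4))

end UlamCode

namespace UlamCode

/-! ### Common subsequences of words -/

/-! A multipermutation is treated as a word with `r` ones and `r` twos. Multipermutations at Ulam
distance at most `t` give words with a common subsequence of length at least `n - t`, so it suffices
to bound balls of words.

Radius one: a word other than the center arises by moving one letter, a cyclic shift of an interval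
`[i, j]` in one of two directions. Encode letters as signs `±1`. A shift that changes the word can
be shortened until the moved letter differs both from its neighbour inside the interval and from the
letter at the far end. Summation by parts, with total sign sum zero, shows that a word with `k`
maximal alternating blocks has exactly `(2r - k + 1) r` such shifts, both directions together. For
two opposite signs in one alternating block the two directions give the same word, so the number `A`
of these pairs can be subtracted: the ball has at most `1 + (2r - k + 1) r - A` words
(`exists_card_wordBall_one_le`). A block of length `b` contributes at least `(b² - 1) / 4` pairs, so
Cauchy–Schwarz gives `4A ≥ 4r² / k - k`. Minimizing over `k` near `√r` yields the bound
(`lt_sphereBound`).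

Larger radius: `t` letter moves reach the whole ball, so its size is at most `U(r) ^ t`. A code
whose balls of radius `t` cover all `n! / (r!)²` multipermutations therefore has at least `n! /
((r!)² U(r) ^ t)` elements. A perfect code covers with `t = 1`, a maximal code with `t = d - 1`. -/

theorem exists_insert_sublist {α : Type*} {l y : List α} (h : l.Sublist y)
    (hlt : l.length < y.length) :
    ∃ l₁ v l₂, l = l₁ ++ l₂ ∧ (l₁ ++ v :: l₂).Sublist y := by
  induction h with
  | slnil => simp at hlt
  | @cons l y a h _ => exact ⟨[], a, l, rfl, h.cons_cons a⟩
  | @cons_cons l y a h ih =>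
    obtain ⟨l₁, v, l₂, rfl, h'⟩ := ih (by simpa using hlt)
    exact ⟨a :: l₁, v, l₂, rfl, h'.cons_cons a⟩

theorem exists_erase_sublist {α : Type*} [DecidableEq α] {l x : List α} {v : α}
    (h : l.Sublist x) (hlt : l.count v < x.count v) :
    ∃ a b, x = a ++ v :: b ∧ l.Sublist (a ++ b) := by
  induction h with
  | slnil => simp at hlt
  | @cons l y a h ih =>
    by_cases hav : a = v
    · exact ⟨[], y, by simp [hav], h⟩
    · obtain ⟨p, q, rfl, h'⟩ := ih (by simpa [List.count_cons, hav] using hlt)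
      exact ⟨a :: p, q, rfl, h'.cons a⟩
  | @cons_cons l y a h ih =>
    obtain ⟨p, q, rfl, h'⟩ := ih (by simpa [List.count_cons] using hlt)
    exact ⟨a :: p, q, rfl, h'.cons_cons a⟩

/-- `x` and `y` have a common subsequence of length at least `x.length - t`. -/
def CommonSub {α : Type*} (t : ℕ) (x y : List α) : Prop :=
  ∃ l : List α, l.Sublist x ∧ l.Sublist y ∧ x.length ≤ l.length + t

/-- One letter move in `x` lengthens the common subsequence: insert into `l` a letter `v` of `y`
that it misses. By equal letter counts `x` has a spare `v`, which can be moved to the matching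
place. -/
theorem CommonSub.exists_translocation {α : Type*} [DecidableEq α] {t : ℕ} {x y : List α}
    (h : CommonSub (t + 1) x y) (hp : y.Perm x) :
    ∃ z, z.Perm x ∧ CommonSub 1 x z ∧ CommonSub t z y := by
  obtain ⟨l, hx, hy, hlen⟩ := h
  by_cases hlt : x.length ≤ l.length + t
  · exact ⟨x, List.Perm.refl x, ⟨x, List.Sublist.refl x, List.Sublist.refl x, by omega⟩,
      l, hx, hy, hlt⟩
  obtain ⟨l₁, v, l₂, rfl, hv⟩ := exists_insert_sublist hy (by have := hp.length_eq; omega)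
  have hcount : (l₁ ++ l₂).count v < x.count v := by
    have h1 := hv.count_le v
    rw [hp.count_eq] at h1
    simp only [List.count_append, List.count_cons_self] at h1 ⊢
    omega
  obtain ⟨a, b, rfl, hab⟩ := exists_erase_sublist hx hcount
  obtain ⟨c, d, hcd, hc, hd⟩ := List.append_sublist_iff.1 hab
  have hperm : (c ++ v :: d).Perm (a ++ v :: b) := by
    refine List.perm_middle.trans (List.Perm.trans ?_ List.perm_middle.symm)
    rw [hcd]
  refine ⟨c ++ v :: d, hperm, ⟨a ++ b, ?_, ?_, ?_⟩, l₁ ++ v :: l₂, ?_, hv, ?_⟩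
  · exact List.Sublist.append_left (List.sublist_cons_self v b) a
  · rw [hcd]
    exact List.Sublist.append_left (List.sublist_cons_self v d) c
  · simp; omega
  · exact hc.append (hd.cons_cons v)
  · rw [hperm.length_eq]
    simp at hlen ⊢
    omega

/-- If `x ≠ y`, both arise from `l` by inserting one letter, the same one by equal letter counts.
The order of the two insertion places gives the two cases. -/
theorem CommonSub.eq_append {α : Type*} [DecidableEq α] {x y : List α} (h : CommonSub 1 x y)
    (hp : y.Perm x) :
    x = y ∨ ∃ a e d v, (x = a ++ v :: (e ++ d) ∧ y = a ++ (e ++ v :: d)) ∨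
      (x = a ++ (e ++ v :: d) ∧ y = a ++ v :: (e ++ d)) := by
  obtain ⟨l, hx, hy, hlen⟩ := h
  by_cases hlt : x.length ≤ l.length
  · have h1 := hx.eq_of_length_le hlt
    have h2 := hy.eq_of_length_le (by rw [hp.length_eq]; exact hlt)
    exact Or.inl (h1.symm.trans h2)
  right
  obtain ⟨l₁, v, l₂, rfl, hv⟩ := exists_insert_sublist hy (by have := hp.length_eq; omega)
  have hyl : l₁ ++ v :: l₂ = y := hv.eq_of_length_le (by
    rw [hp.length_eq]; simp at hlen ⊢; omega)
  subst hyl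
  have hcount : (l₁ ++ l₂).count v < x.count v := by
    rw [← hp.count_eq]
    simp only [List.count_append, List.count_cons_self]
    omega
  obtain ⟨a, b, rfl, hab⟩ := exists_erase_sublist hx hcount
  have hab' := hab.eq_of_length_le (by simp at hlen ⊢; omega)
  rcases List.append_eq_append_iff.1 hab' with ⟨e, rfl, rfl⟩ | ⟨e, rfl, rfl⟩
  · exact ⟨l₁, e, b, v, Or.inr ⟨by simp, rfl⟩⟩
  · exact ⟨a, e, l₂, v, Or.inl ⟨rfl, by simp⟩⟩

/-- The words with the letters of `x` that have a common subsequence of length at least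
`x.length - t` with `x`. -/
noncomputable def wordBall (x : List ℕ) (t : ℕ) : Finset (List ℕ) :=
  open Classical in x.permutations.toFinset.filter fun y => CommonSub t x y

theorem mem_wordBall {x y : List ℕ} {t : ℕ} :
    y ∈ wordBall x t ↔ y.Perm x ∧ CommonSub t x y := by
  simp [wordBall]

theorem wordBall_succ_subset (x : List ℕ) (t : ℕ) :
    wordBall x (t + 1) ⊆ (wordBall x 1).biUnion fun z => wordBall z t := by
  intro y hy
  rw [mem_wordBall] at hy
  obtain ⟨z, hz, h1, h2⟩ := hy.2.exists_translocation hy.1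
  rw [Finset.mem_biUnion]
  exact ⟨z, mem_wordBall.2 ⟨hz, h1⟩, mem_wordBall.2 ⟨hy.1.trans hz.symm, h2⟩⟩

theorem card_wordBall_zero (x : List ℕ) : (wordBall x 0).card ≤ 1 := by
  rw [Finset.card_le_one_iff_subset_singleton]
  refine ⟨x, fun y hy => ?_⟩
  obtain ⟨hp, l, hx, hy, hlen⟩ := mem_wordBall.1 hy
  rw [Finset.mem_singleton, ← hx.eq_of_length_le hlen]
  exact (hy.eq_of_length_le (by rw [hp.length_eq]; exact hlen)).symm

/-! ### Sign sequences -/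

/-- Cyclic shift of the entries at `i, …, j` that moves the entry at `i` to `j`. -/
def rotL (e : ℕ → ℤ) (i j : ℕ) : ℕ → ℤ := fun t =>
  if t < i ∨ j < t then e t else if t < j then e (t + 1) else e i

/-- Cyclic shift of the entries at `i, …, j` that moves the entry at `j` to `i`. -/
def rotR (e : ℕ → ℤ) (i j : ℕ) : ℕ → ℤ := fun t =>
  if t < i ∨ j < t then e t else if i < t then e (t - 1) else e j

/-- The sign sequence of a word over `{1, 2}`. -/
def signSeq (x : List ℕ) : ℕ → ℤ := fun t => if x.getD t 0 = 1 then 1 else -1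

theorem signSeq_translocate (a e d : List ℕ) (v : ℕ) :
    signSeq (a ++ (e ++ v :: d)) =
      rotL (signSeq (a ++ v :: (e ++ d))) a.length (a.length + e.length) := by
  funext t
  have key : (a ++ (e ++ v :: d)).getD t 0 =
      if t < a.length ∨ a.length + e.length < t then (a ++ v :: (e ++ d)).getD t 0
      else if t < a.length + e.length then (a ++ v :: (e ++ d)).getD (t + 1) 0
      else (a ++ v :: (e ++ d)).getD a.length 0 := by
    simp only [List.getD_eq_getElem?_getD, List.getElem?_append, List.getElem?_cons]
    grind
  simp only [signSeq, rotL, key]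
  split_ifs <;> simp_all

theorem signSeq_translocate' (a e d : List ℕ) (v : ℕ) :
    signSeq (a ++ v :: (e ++ d)) =
      rotR (signSeq (a ++ (e ++ v :: d))) a.length (a.length + e.length) := by
  funext t
  have key : (a ++ v :: (e ++ d)).getD t 0 =
      if t < a.length ∨ a.length + e.length < t then (a ++ (e ++ v :: d)).getD t 0
      else if a.length < t then (a ++ (e ++ v :: d)).getD (t - 1) 0
      else (a ++ (e ++ v :: d)).getD (a.length + e.length) 0 := by
    simp only [List.getD_eq_getElem?_getD, List.getElem?_append, List.getElem?_cons]
    grind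
  simp only [signSeq, rotR, key]
  split_ifs <;> simp_all

/-! ### Shifts that cannot be shortened -/

/-- Moving an entry past an equal neighbour does nothing, so `i` may be increased; if the far entry
equals the moved one, `j` may be decreased. -/
theorem rotL_canonical (e : ℕ → ℤ) (m : ℕ) : ∀ i j, i ≤ j → j - i = m → rotL e i j = e ∨
    ∃ i' j', i' < j' ∧ j' ≤ j ∧ e i' ≠ e (i' + 1) ∧ e i' ≠ e j' ∧
      rotL e i j = rotL e i' j' := by
  induction m with
  | zero =>
    intro i j hij hm
    left
    obtain rfl : i = j := by omega
    funext t
    simp only [rotL]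
    split_ifs with h1 h2
    · rfl
    · omega
    · congr 1; omega
  | succ m ih =>
    intro i j hij hm
    by_cases h1 : e i = e (i + 1)
    · have : rotL e i j = rotL e (i + 1) j := by
        funext t
        simp only [rotL]
        grind
      rw [this]
      exact ih (i + 1) j (by omega) (by omega)
    by_cases h2 : e i = e j
    · have : rotL e i j = rotL e i (j - 1) := by
        funext t
        simp only [rotL]
        grind
      rw [this]
      rcases ih i (j - 1) (by omega) (by omega) with h | ⟨i', j', h⟩
      · exact Or.inl h
      · exact Or.inr ⟨i', j', h.1, by omega, h.2.2⟩
    exact Or.inr ⟨i, j, by omega, le_rfl, h1, h2, rfl⟩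

theorem rotR_canonical (e : ℕ → ℤ) (m : ℕ) : ∀ i j, i ≤ j → j - i = m → rotR e i j = e ∨
    ∃ i' j', i' < j' ∧ j' ≤ j ∧ e j' ≠ e (j' - 1) ∧ e i' ≠ e j' ∧
      rotR e i j = rotR e i' j' := by
  induction m with
  | zero =>
    intro i j hij hm
    left
    obtain rfl : i = j := by omega
    funext t
    simp only [rotR]
    split_ifs with h1 h2
    · rfl
    · omega
    · congr 1; omega
  | succ m ih =>
    intro i j hij hm
    by_cases h1 : e j = e (j - 1)
    · have : rotR e i j = rotR e i (j - 1) := by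
        funext t
        simp only [rotR]
        grind
      rw [this]
      rcases ih i (j - 1) (by omega) (by omega) with h | ⟨i', j', h⟩
      · exact Or.inl h
      · exact Or.inr ⟨i', j', h.1, by omega, h.2.2⟩
    by_cases h2 : e i = e j
    · have : rotR e i j = rotR e (i + 1) j := by
        funext t
        simp only [rotR]
        grind
      rw [this]
      exact ih (i + 1) j (by omega) (by omega)
    exact Or.inr ⟨i, j, by omega, le_rfl, h1, h2, rfl⟩

theorem signSeq_of_mem_wordBall {x y : List ℕ} (hy : y ∈ wordBall x 1) :
    signSeq y = signSeq x ∨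
    (∃ i j, i < j ∧ j < x.length ∧ signSeq x i ≠ signSeq x (i + 1) ∧
      signSeq x i ≠ signSeq x j ∧ signSeq y = rotL (signSeq x) i j) ∨
    (∃ i j, i < j ∧ j < x.length ∧ signSeq x j ≠ signSeq x (j - 1) ∧
      signSeq x i ≠ signSeq x j ∧ signSeq y = rotR (signSeq x) i j) := by
  obtain ⟨hp, hc⟩ := mem_wordBall.1 hy
  rcases hc.eq_append hp with rfl | ⟨a, e, d, v, ⟨hx, hy⟩ | ⟨hx, hy⟩⟩
  · exact Or.inl rfl
  · have h := signSeq_translocate a e d v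
    rw [← hx, ← hy] at h
    rcases rotL_canonical (signSeq x) _ a.length (a.length + e.length) (by omega) rfl with
      h' | ⟨i, j, h1, h2, h3, h4, h5⟩
    · exact Or.inl (h.trans h')
    · refine Or.inr (Or.inl ⟨i, j, h1, ?_, h3, h4, h.trans h5⟩)
      rw [hx]; simp; omega
  · have h := signSeq_translocate' a e d v
    rw [← hx, ← hy] at h
    rcases rotR_canonical (signSeq x) _ a.length (a.length + e.length) (by omega) rfl with
      h' | ⟨i, j, h1, h2, h3, h4, h5⟩
    · exact Or.inl (h.trans h')
    · refine Or.inr (Or.inr ⟨i, j, h1, ?_, h3, h4, h.trans h5⟩)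
      rw [hx]; simp; omega

/-! ### Counting the shifts that cannot be shortened -/

/-- Summation by parts, with `e t ^ 2 = 1`. -/
theorem sum_sub_mul_prefix_sum {e : ℕ → ℤ} (he : ∀ t, e t = 1 ∨ e t = -1) (m : ℕ) :
    ∑ p ∈ Finset.range m, (e p - e (p + 1)) * ∑ t ∈ Finset.range (p + 1), e t =
      (m + 1) - e m * ∑ t ∈ Finset.range (m + 1), e t := by
  have hsq : ∀ t, e t * e t = 1 := fun t => by rcases he t with h | h <;> simp [h]
  induction m with
  | zero => simp [hsq]
  | succ m ih =>
    rw [Finset.sum_range_succ, ih, Finset.sum_range_succ _ (m + 1)]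
    push_cast
    linear_combination hsq (m + 1)

/-- The pairs `(i, j)` such that moving the entry at `i` to `j` is a shift that cannot be
shortened. -/
def leftPairs (e : ℕ → ℤ) (n : ℕ) : Finset (ℕ × ℕ) :=
  (Finset.range n ×ˢ Finset.range n).filter fun q =>
    q.1 < q.2 ∧ e q.1 ≠ e (q.1 + 1) ∧ e q.1 ≠ e q.2

/-- The pairs `(i, j)` such that moving the entry at `j` to `i` is a shift that cannot be
shortened. -/
def rightPairs (e : ℕ → ℤ) (n : ℕ) : Finset (ℕ × ℕ) :=
  (Finset.range n ×ˢ Finset.range n).filter fun q =>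
    q.1 < q.2 ∧ e q.2 ≠ e (q.2 - 1) ∧ e q.1 ≠ e q.2

/-- The positions `p < m` at which the sign changes. -/
def changes (e : ℕ → ℤ) (m : ℕ) : Finset ℕ := (Finset.range m).filter fun p => e p ≠ e (p + 1)

/-- The number of positions `p < t` at which the sign does not change: the index of the maximal
alternating block that contains `t`. -/
def block (e : ℕ → ℤ) (t : ℕ) : ℕ := ((Finset.range t).filter fun p => e p = e (p + 1)).card

/-- The pairs `(i, j)` of positions with different signs in a common maximal alternating block. -/
def altPairs (e : ℕ → ℤ) (n : ℕ) : Finset (ℕ × ℕ) :=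
  (Finset.range n ×ˢ Finset.range n).filter fun q =>
    q.1 < q.2 ∧ block e q.1 = block e q.2 ∧ e q.1 ≠ e q.2

theorem ite_ne_eq {a b : ℤ} (ha : a = 1 ∨ a = -1) (hb : b = 1 ∨ b = -1) :
    2 * (if a ≠ b then (1 : ℤ) else 0) = 1 - a * b := by
  rcases ha with rfl | rfl <;> rcases hb with rfl | rfl <;> norm_num

/-- A sign change at `p` allows every `j > p` with the sign opposite to `e p`; the vanishing total
turns the sum over `j > p` into a prefix sum. -/
theorem two_mul_card_leftPairs {e : ℕ → ℤ} (he : ∀ t, e t = 1 ∨ e t = -1) (m : ℕ)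
    (h0 : ∑ t ∈ Finset.range (m + 1), e t = 0) :
    2 * ((leftPairs e (m + 1)).card : ℤ) = ∑ p ∈ changes e m,
      ((m : ℤ) - p + e p * ∑ t ∈ Finset.range (p + 1), e t) := by
  have hset : leftPairs e (m + 1) = (changes e m).biUnion fun p =>
      ((Finset.Ico (p + 1) (m + 1)).filter fun j => e p ≠ e j).image fun j => (p, j) := by
    ext ⟨i, j⟩
    simp only [leftPairs, changes, Finset.mem_filter, Finset.mem_product, Finset.mem_range,
      Finset.mem_biUnion, Finset.mem_image, Finset.mem_Ico, Prod.mk.injEq]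
    constructor
    · rintro ⟨⟨h1, h2⟩, h3, h4, h5⟩
      exact ⟨i, ⟨by omega, h4⟩, j, ⟨⟨by omega, by omega⟩, h5⟩, rfl, rfl⟩
    · rintro ⟨p, ⟨h1, h2⟩, q, ⟨⟨h3, h4⟩, h5⟩, rfl, rfl⟩
      exact ⟨⟨by omega, by omega⟩, by omega, h2, h5⟩
  rw [hset, Finset.card_biUnion]
  · push_cast
    rw [Finset.mul_sum]
    refine Finset.sum_congr rfl fun p hp => ?_
    have hpm : p < m := by
      simp only [changes, Finset.mem_filter, Finset.mem_range] at hp; exact hp.1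
    rw [Finset.card_image_of_injective _ (Prod.mk_right_injective p), Finset.card_filter]
    push_cast
    rw [Finset.mul_sum, Finset.sum_congr rfl fun j _ => ite_ne_eq (he p) (he j),
      Finset.sum_sub_distrib, ← Finset.mul_sum]
    have h := Finset.sum_range_add_sum_Ico e (show p + 1 ≤ m + 1 by omega)
    rw [h0] at h
    rw [show ∑ j ∈ Finset.Ico (p + 1) (m + 1), e j = - ∑ t ∈ Finset.range (p + 1), e t by
      linarith]
    simp only [Finset.sum_const, Nat.card_Ico, nsmul_eq_mul, mul_one]
    rw [Nat.add_sub_add_right, Nat.cast_sub hpm.le]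
    ring
  · intro p _ q _ hpq
    rw [Function.onFun, Finset.disjoint_left]
    intro z hz hz'
    obtain ⟨_, _, rfl⟩ := Finset.mem_image.1 hz
    obtain ⟨_, _, h⟩ := Finset.mem_image.1 hz'
    exact hpq (Prod.ext_iff.1 h).1.symm

/-- Here the moved entry sits at `p + 1`, just after the sign change, and `e (p + 1) = - e p`. -/
theorem two_mul_card_rightPairs {e : ℕ → ℤ} (he : ∀ t, e t = 1 ∨ e t = -1) (m : ℕ) :
    2 * ((rightPairs e (m + 1)).card : ℤ) = ∑ p ∈ changes e m,
      ((p : ℤ) + 1 + e p * ∑ t ∈ Finset.range (p + 1), e t) := by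
  have hset : rightPairs e (m + 1) = (changes e m).biUnion fun p =>
      ((Finset.range (p + 1)).filter fun i => e (p + 1) ≠ e i).image fun i => (i, p + 1) := by
    ext ⟨i, j⟩
    simp only [rightPairs, changes, Finset.mem_filter, Finset.mem_product, Finset.mem_range,
      Finset.mem_biUnion, Finset.mem_image, Prod.mk.injEq]
    constructor
    · rintro ⟨⟨h1, h2⟩, h3, h4, h5⟩
      obtain ⟨p, rfl⟩ : ∃ p, j = p + 1 := ⟨j - 1, by omega⟩
      exact ⟨p, ⟨by omega, fun h => h4 h.symm⟩, i, ⟨by omega, fun h => h5 h.symm⟩, rfl, rfl⟩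
    · rintro ⟨p, ⟨h1, h2⟩, q, ⟨h3, h5⟩, rfl, rfl⟩
      exact ⟨⟨by omega, by omega⟩, by omega, fun h => h2 h.symm, fun h => h5 h.symm⟩
  rw [hset, Finset.card_biUnion]
  · push_cast
    rw [Finset.mul_sum]
    refine Finset.sum_congr rfl fun p hp => ?_
    have hp' : e (p + 1) = - e p := by
      simp only [changes, Finset.mem_filter, Finset.mem_range] at hp
      have := hp.2
      rcases he p with h | h <;> rcases he (p + 1) with h' | h' <;> simp_all
    rw [Finset.card_image_of_injective _ (Prod.mk_left_injective (p + 1)), Finset.card_filter]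
    push_cast
    rw [Finset.mul_sum, Finset.sum_congr rfl fun j _ => ite_ne_eq (he (p + 1)) (he j),
      Finset.sum_sub_distrib, ← Finset.mul_sum, hp']
    simp
  · intro p _ q _ hpq
    rw [Function.onFun, Finset.disjoint_left]
    intro z hz hz'
    obtain ⟨_, _, rfl⟩ := Finset.mem_image.1 hz
    obtain ⟨_, _, h⟩ := Finset.mem_image.1 hz'
    have := (Prod.ext_iff.1 h).2
    simp at this
    exact hpq this.symm

/-- The position-dependent terms cancel between the two directions, and the prefix-sum terms add up
to `m + 1` whatever the word. -/
theorem two_mul_card_leftPairs_add_rightPairs {e : ℕ → ℤ} (he : ∀ t, e t = 1 ∨ e t = -1) (m : ℕ)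
    (h0 : ∑ t ∈ Finset.range (m + 1), e t = 0) :
    2 * ((leftPairs e (m + 1)).card + (rightPairs e (m + 1)).card : ℤ) =
      ((changes e m).card + 1) * (m + 1) := by
  have hsum : 2 * ∑ p ∈ changes e m, e p * ∑ t ∈ Finset.range (p + 1), e t = m + 1 := by
    have h := sum_sub_mul_prefix_sum he m
    rw [h0] at h
    rw [changes, Finset.sum_filter, Finset.mul_sum]
    rw [mul_zero, sub_zero] at h
    rw [← h]
    refine Finset.sum_congr rfl fun p _ => ?_
    rcases he p with h | h <;> rcases he (p + 1) with h' | h' <;> simp [h, h']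
  rw [mul_add, two_mul_card_leftPairs he m h0, two_mul_card_rightPairs he m,
    ← Finset.sum_add_distrib]
  have : ∀ p ∈ changes e m, ((m : ℤ) - p + e p * ∑ t ∈ Finset.range (p + 1), e t +
      ((p : ℤ) + 1 + e p * ∑ t ∈ Finset.range (p + 1), e t)) =
      ((m : ℤ) + 1) + 2 * (e p * ∑ t ∈ Finset.range (p + 1), e t) := fun p _ => by ring
  rw [Finset.sum_congr rfl this, Finset.sum_add_distrib, ← Finset.mul_sum, hsum]
  simp
  ring

/-! ### Maximal alternating blocks -/

theorem card_changes_add_block (e : ℕ → ℤ) (m : ℕ) : (changes e m).card + block e m = m := by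
  have h := Finset.card_filter_add_card_filter_not (s := Finset.range m)
    (fun p => e p = e (p + 1))
  rw [Finset.card_range] at h
  simp only [changes, block, ne_eq]
  omega

theorem block_mono (e : ℕ → ℤ) : Monotone (block e) := fun s t hst => by
  refine Finset.card_le_card (Finset.filter_subset_filter _ ?_)
  exact Finset.range_subset_range.2 hst

theorem block_succ (e : ℕ → ℤ) (t : ℕ) :
    block e (t + 1) = block e t + if e t = e (t + 1) then 1 else 0 := by
  rw [block, block, Finset.range_add_one, Finset.filter_insert]
  split_ifs <;> simp

theorem neg_of_block_eq {e : ℕ → ℤ} (he : ∀ t, e t = 1 ∨ e t = -1) {i j t : ℕ}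
    (h : block e i = block e j) (hi : i ≤ t) (hj : t < j) : e (t + 1) = - e t := by
  have h1 := block_mono e hi
  have h2 := block_mono e (show t + 1 ≤ j from hj)
  have h3 := block_succ e t
  have h4 : e t ≠ e (t + 1) := by
    intro h4
    rw [if_pos h4] at h3
    omega
  rcases he t with h | h <;> rcases he (t + 1) with h' | h' <;> simp_all

theorem altPairs_subset_rightPairs {e : ℕ → ℤ} (he : ∀ t, e t = 1 ∨ e t = -1) (n : ℕ) :
    altPairs e n ⊆ rightPairs e n := by
  rintro ⟨i, j⟩ h
  simp only [altPairs, rightPairs, Finset.mem_filter] at h ⊢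
  obtain ⟨h1, h2, h3, h4⟩ := h
  refine ⟨h1, h2, ?_, h4⟩
  obtain ⟨p, rfl⟩ : ∃ p, j = p + 1 := ⟨j - 1, by omega⟩
  have := neg_of_block_eq he h3 (t := p) (by omega) (by omega)
  rw [this, Nat.add_sub_cancel]
  rcases he p with h | h <;> rw [h] <;> norm_num

theorem altPairs_subset_leftPairs {e : ℕ → ℤ} (he : ∀ t, e t = 1 ∨ e t = -1) (n : ℕ) :
    altPairs e n ⊆ leftPairs e n := by
  rintro ⟨i, j⟩ h
  simp only [altPairs, leftPairs, Finset.mem_filter] at h ⊢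
  obtain ⟨h1, h2, h3, h4⟩ := h
  refine ⟨h1, h2, ?_, h4⟩
  have := neg_of_block_eq he h3 (t := i) le_rfl h2
  rw [this]
  rcases he i with h | h <;> rw [h] <;> norm_num

/-- On an alternating interval with opposite ends both shifts negate every entry. -/
theorem rotR_eq_rotL_of_mem_altPairs {e : ℕ → ℤ} (he : ∀ t, e t = 1 ∨ e t = -1) {n : ℕ}
    {q : ℕ × ℕ} (h : q ∈ altPairs e n) : rotR e q.1 q.2 = rotL e q.1 q.2 := by
  obtain ⟨i, j⟩ := q
  simp only [altPairs, Finset.mem_filter] at h ⊢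
  obtain ⟨h1, h2, h3, h4⟩ := h
  have hneg : ∀ t, i ≤ t → t < j → e (t + 1) = - e t := fun t => neg_of_block_eq he h3
  have hij : e j = - e i := by
    rcases he i with h | h <;> rcases he j with h' | h' <;> simp_all
  funext t
  simp only [rotR, rotL]
  split_ifs with c1 c2 c3 c3
  · rfl
  · have a := hneg t (by omega) c3
    have b := hneg (t - 1) (by omega) (by omega)
    rw [Nat.sub_add_cancel (by omega)] at b
    rw [a, b, neg_neg]
  · have b := hneg (t - 1) (by omega) (by omega)
    rw [Nat.sub_add_cancel (by omega), show t = j by omega, hij] at b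
    rw [show t = j by omega]
    linarith
  · rw [show t = i by omega, hneg i le_rfl h2, hij]
  · omega

theorem block_sum_bound {e : ℕ → ℤ} (he : ∀ t, e t = 1 ∨ e t = -1) (s m : ℕ) :
    (∑ t ∈ (Finset.range m).filter (fun t => block e t = s), e t) ^ 2 ≤ 1 := by
  set T : ℕ → ℤ := fun m => ∑ t ∈ (Finset.range m).filter (fun t => block e t = s), e t with hT
  have hsucc : ∀ m, T (m + 1) = T m + if block e m = s then e m else 0 := fun m => by
    simp only [hT, Finset.sum_filter, Finset.sum_range_succ]
  -- Signs alternate inside block `s`, so before `m` is added the running sum is either zero or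
  -- cancelled by `e m`.
  have key : ∀ m, T m ^ 2 ≤ 1 ∧ (block e m = s → T m = 0 ∨ T m = - e m) ∧
      (block e m < s → T m = 0) := by
    intro m
    induction m with
    | zero => simp [hT]
    | succ m ih =>
      obtain ⟨h1, h2, h3⟩ := ih
      have hb := block_succ e m
      rw [hsucc]
      split_ifs at hb with hc
      · rcases lt_trichotomy (block e m) s with hs | hs | hs
        · rw [if_neg (by omega), h3 hs]
          simp
        · rw [if_pos hs]
          refine ⟨?_, fun h => by omega, fun h => by omega⟩
          rcases h2 hs with h | h <;> rcases he m with h' | h' <;> simp [h, h']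
        · rw [if_neg (by omega), add_zero]
          exact ⟨h1, fun h => by omega, fun h => by omega⟩
      · have hn : e (m + 1) = - e m := by
          rcases he m with h | h <;> rcases he (m + 1) with h' | h' <;> simp_all
        rcases lt_trichotomy (block e m) s with hs | hs | hs
        · rw [if_neg (by omega), h3 hs]
          simp
        · rw [if_pos hs, hn]
          refine ⟨?_, fun _ => ?_, fun h => by omega⟩ <;>
          rcases h2 hs with h | h <;> rcases he m with h' | h' <;> simp [h, h']
        · rw [if_neg (by omega), add_zero]
          exact ⟨h1, fun h => by omega, fun h => by omega⟩
  exact (key m).1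

/-- Cauchy–Schwarz on the block lengths. Twice the number of ordered pairs of opposite signs in a
block is its squared length minus its squared sign sum, and the latter is at most one. -/
theorem card_altPairs_lower {e : ℕ → ℤ} (he : ∀ t, e t = 1 ∨ e t = -1) (m : ℕ) :
    ((m : ℤ) + 1) ^ 2 ≤ (block e m + 1) * (4 * (altPairs e (m + 1)).card + (block e m + 1)) := by
  set k := block e m + 1 with hk
  set B : ℕ → Finset ℕ := fun s => (Finset.range (m + 1)).filter fun t => block e t = s with hB
  have hmaps : Set.MapsTo (block e) (Finset.range (m + 1) : Set ℕ) (Finset.range k : Set ℕ) := by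
    intro t ht
    simp only [Finset.coe_range, Set.mem_Iio] at ht ⊢
    have := block_mono e (show t ≤ m by omega)
    omega
  have hcard : ∑ s ∈ Finset.range k, ((B s).card : ℤ) = m + 1 := by
    have := Finset.card_eq_sum_card_fiberwise hmaps
    rw [Finset.card_range] at this
    exact_mod_cast this.symm
  have hcs : ((m : ℤ) + 1) ^ 2 ≤ k * ∑ s ∈ Finset.range k, ((B s).card : ℤ) ^ 2 := by
    have := sq_sum_le_card_mul_sum_sq (s := Finset.range k) (f := fun s => ((B s).card : ℤ))
    rwa [hcard, Finset.card_range] at this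
  have halt : 4 * ((altPairs e (m + 1)).card : ℤ) =
      ∑ s ∈ Finset.range k, (((B s).card : ℤ) ^ 2 - (∑ t ∈ B s, e t) ^ 2) := by
    set P := (Finset.range (m + 1) ×ˢ Finset.range (m + 1)).filter fun q : ℕ × ℕ =>
      block e q.1 = block e q.2 ∧ e q.1 ≠ e q.2 with hP
    have hPcard : P.card = 2 * (altPairs e (m + 1)).card := by
      rw [← Finset.card_filter_add_card_filter_not (s := P) (fun q => q.1 < q.2), two_mul]
      congr 1
      · congr 1
        ext q
        simp only [hP, altPairs, Finset.mem_filter]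
        tauto
      · refine Finset.card_bij' (fun q _ => q.swap) (fun q _ => q.swap) ?_ ?_ ?_ ?_
        · rintro ⟨i, j⟩ h
          simp only [hP, altPairs, Finset.mem_filter, Finset.mem_product, Prod.swap] at h ⊢
          have : i ≠ j := fun h' => h.1.2.2 (by rw [h'])
          exact ⟨h.1.1.symm, by omega, h.1.2.1.symm, h.1.2.2.symm⟩
        · rintro ⟨i, j⟩ h
          simp only [hP, altPairs, Finset.mem_filter, Finset.mem_product, Prod.swap] at h ⊢
          exact ⟨⟨h.1.symm, h.2.2.1.symm, h.2.2.2.symm⟩, by omega⟩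
        · simp
        · simp
    have hfib : P.card = ∑ s ∈ Finset.range k,
        ((B s ×ˢ B s).filter fun q : ℕ × ℕ => e q.1 ≠ e q.2).card := by
      have hPm : Set.MapsTo (fun q : ℕ × ℕ => block e q.1) (P : Set (ℕ × ℕ))
          (Finset.range k : Set ℕ) := by
        intro q hq
        simp only [hP, Finset.coe_filter, Finset.mem_product, Set.mem_ofPred_eq] at hq
        exact hmaps (Finset.mem_coe.2 hq.1.1)
      rw [Finset.card_eq_sum_card_fiberwise hPm]
      refine Finset.sum_congr rfl fun s _ => ?_
      congr 1
      ext ⟨i, j⟩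
      simp only [hP, hB, Finset.mem_filter, Finset.mem_product]
      constructor
      · rintro ⟨⟨⟨h1, h2⟩, h3, h4⟩, h5⟩
        exact ⟨⟨⟨h1, h5⟩, h2, h3.symm.trans h5⟩, h4⟩
      · rintro ⟨⟨⟨h1, h5⟩, h2, h3⟩, h4⟩
        exact ⟨⟨⟨h1, h2⟩, h5.trans h3.symm, h4⟩, h5⟩
    have h4 : 4 * ((altPairs e (m + 1)).card : ℤ) = 2 * (P.card : ℤ) := by
      rw [hPcard]; push_cast; ring
    rw [h4, hfib]
    push_cast
    rw [Finset.mul_sum]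
    refine Finset.sum_congr rfl fun s _ => ?_
    rw [Finset.card_filter]
    push_cast
    rw [Finset.mul_sum, Finset.sum_congr rfl fun q _ => ite_ne_eq (he q.1) (he q.2),
      Finset.sum_sub_distrib, Finset.sum_product' (B s) (B s) fun i j => e i * e j,
      ← Finset.sum_mul_sum]
    simp
    ring
  have hle : ∑ s ∈ Finset.range k, (∑ t ∈ B s, e t) ^ 2 ≤ (k : ℤ) := by
    calc ∑ s ∈ Finset.range k, (∑ t ∈ B s, e t) ^ 2 ≤ ∑ _s ∈ Finset.range k, (1 : ℤ) :=
          Finset.sum_le_sum fun s _ => block_sum_bound he s (m + 1)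
      _ = k := by simp
  rw [Finset.sum_sub_distrib] at halt
  have hk' : ((block e m : ℤ) + 1) = k := by rw [hk]; push_cast; ring
  rw [hk']
  refine hcs.trans (mul_le_mul_of_nonneg_left ?_ (by positivity))
  linarith

/-! ### Balanced words and the ball of radius one -/

/-- A word with `r` letters `1` and `r` letters `2`. -/
def IsBalanced (r : ℕ) (x : List ℕ) : Prop :=
  x.length = 2 * r ∧ (∀ a ∈ x, a = 1 ∨ a = 2) ∧
    (x.map fun a => if a = 1 then (1 : ℤ) else -1).sum = 0

theorem IsBalanced.perm {r : ℕ} {x y : List ℕ} (h : IsBalanced r x) (hp : y.Perm x) :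
    IsBalanced r y :=
  ⟨hp.length_eq.trans h.1, fun a ha => h.2.1 a (hp.mem_iff.1 ha),
    (hp.map _).sum_eq.trans h.2.2⟩

theorem signSeq_eq (x : List ℕ) (t : ℕ) : signSeq x t = 1 ∨ signSeq x t = -1 := by
  unfold signSeq
  split_ifs <;> simp

theorem sum_signSeq (x : List ℕ) : ∑ t ∈ Finset.range x.length, signSeq x t =
    (x.map fun a => if a = 1 then (1 : ℤ) else -1).sum := by
  induction x with
  | nil => simp
  | cons a x ih =>
    rw [List.length_cons, Finset.sum_range_succ', List.map_cons, List.sum_cons, ← ih, add_comm]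
    simp [signSeq]

theorem signSeq_inj {r : ℕ} {x y : List ℕ} (hx : IsBalanced r x) (hy : IsBalanced r y)
    (h : signSeq x = signSeq y) : x = y := by
  refine List.ext_getElem (hx.1.trans hy.1.symm) fun t h1 h2 => ?_
  have ht := congrFun h t
  simp only [signSeq, List.getD_eq_getElem _ _ h1, List.getD_eq_getElem _ _ h2] at ht
  rcases hx.2.1 _ (List.getElem_mem h1) with h3 | h3 <;>
  rcases hy.2.1 _ (List.getElem_mem h2) with h4 | h4 <;> simp_all

theorem card_wordBall_one_add {r : ℕ} {x : List ℕ} (hx : IsBalanced r x) :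
    (wordBall x 1).card + (altPairs (signSeq x) (2 * r)).card ≤
      1 + (leftPairs (signSeq x) (2 * r)).card + (rightPairs (signSeq x) (2 * r)).card := by
  classical
  set e := signSeq x with he
  have he1 : ∀ t, e t = 1 ∨ e t = -1 := signSeq_eq x
  have hinj : Set.InjOn signSeq (wordBall x 1 : Set (List ℕ)) := fun y hy z hz h =>
    signSeq_inj (hx.perm (mem_wordBall.1 hy).1) (hx.perm (mem_wordBall.1 hz).1) h
  -- Right shifts along `altPairs` are left out, since the left shifts already produce those words.
  have hsub : (wordBall x 1).image signSeq ⊆ ({e} ∪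
      (leftPairs e (2 * r)).image fun q => rotL e q.1 q.2) ∪
      (rightPairs e (2 * r) \ altPairs e (2 * r)).image fun q => rotR e q.1 q.2 := by
    intro f hf
    obtain ⟨y, hy, rfl⟩ := Finset.mem_image.1 hf
    rw [Finset.mem_union, Finset.mem_union, Finset.mem_singleton, Finset.mem_image,
      Finset.mem_image]
    rcases signSeq_of_mem_wordBall hy with h | ⟨i, j, h1, h2, h3, h4, h5⟩ |
      ⟨i, j, h1, h2, h3, h4, h5⟩
    · exact Or.inl (Or.inl h)
    · refine Or.inl (Or.inr ⟨(i, j), ?_, h5.symm⟩)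
      rw [hx.1] at h2
      simp only [leftPairs, Finset.mem_filter, Finset.mem_product, Finset.mem_range]
      exact ⟨⟨by omega, h2⟩, h1, h3, h4⟩
    · by_cases hq : (i, j) ∈ altPairs e (2 * r)
      · exact Or.inl (Or.inr ⟨(i, j), altPairs_subset_leftPairs he1 _ hq,
          (rotR_eq_rotL_of_mem_altPairs he1 hq).symm.trans h5.symm⟩)
      · refine Or.inr ⟨(i, j), Finset.mem_sdiff.2 ⟨?_, hq⟩, h5.symm⟩
        rw [hx.1] at h2
        simp only [rightPairs, Finset.mem_filter, Finset.mem_product, Finset.mem_range]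
        exact ⟨⟨by omega, h2⟩, h1, h3, h4⟩
  have hcard := Finset.card_le_card hsub
  rw [Finset.card_image_of_injOn hinj] at hcard
  have h1 := hcard.trans ((Finset.card_union_le _ _).trans
    (Nat.add_le_add (Finset.card_union_le _ _) le_rfl))
  have h2 : ((leftPairs e (2 * r)).image fun q => rotL e q.1 q.2).card ≤ _ :=
    Finset.card_image_le
  have h3 : ((rightPairs e (2 * r) \ altPairs e (2 * r)).image fun q => rotR e q.1 q.2).card ≤ _ :=
    Finset.card_image_le
  have h4 := Finset.card_sdiff_add_card_eq_card (altPairs_subset_rightPairs he1 (2 * r))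
  rw [Finset.card_singleton] at h1
  omega

/-- The size of a word ball of radius one in terms of the number `k` of maximal alternating
blocks of its center. -/
theorem exists_card_wordBall_one_le {r : ℕ} (hr : 0 < r) {x : List ℕ} (hx : IsBalanced r x) :
    ∃ k A : ℤ, 1 ≤ k ∧ 0 ≤ A ∧ 4 * (r : ℤ) ^ 2 ≤ k * (4 * A + k) ∧
      ((wordBall x 1).card : ℤ) ≤ 1 + (2 * r - k + 1) * r - A := by
  obtain ⟨m, hm⟩ : ∃ m, 2 * r = m + 1 := ⟨2 * r - 1, by omega⟩
  have he := signSeq_eq x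
  have h0 : ∑ t ∈ Finset.range (m + 1), signSeq x t = 0 := by
    rw [← hm, ← hx.1, sum_signSeq, hx.2.2]
  have h1 := card_wordBall_one_add hx
  have h2 := two_mul_card_leftPairs_add_rightPairs he m h0
  have h3 := card_altPairs_lower he m
  have h4 := card_changes_add_block (signSeq x) m
  rw [hm] at h1
  have hm' : (2 * r : ℤ) = m + 1 := by exact_mod_cast hm
  refine ⟨block (signSeq x) m + 1, (altPairs (signSeq x) (m + 1)).card, by omega, by omega, ?_, ?_⟩
  · calc 4 * (r : ℤ) ^ 2 = (2 * r) ^ 2 := by ring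
      _ ≤ _ := by rw [hm']; exact h3
  · have h5 : ((changes (signSeq x) m).card : ℤ) = 2 * r - (block (signSeq x) m + 1) := by
      rw [hm']; omega
    rw [h5, ← hm'] at h2
    have h6 : ((leftPairs (signSeq x) (m + 1)).card + (rightPairs (signSeq x) (m + 1)).card : ℤ) =
      (2 * r - (block (signSeq x) m + 1) + 1) * r := by linarith
    rw [← h6]
    omega

/-! ### Comparison with `U(r)` -/

theorem lt_sphereBound {r : ℕ} (hr : 2 ≤ r) {k A : ℝ} (hk : 1 ≤ k)
    (h : 4 * (r : ℝ) ^ 2 ≤ k * (4 * A + k)) :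
    1 + (2 * r - k + 1) * r - A < sphereBound r := by
  unfold sphereBound
  set c := Real.sqrt r with hc
  have hr' : (2 : ℝ) ≤ r := by exact_mod_cast hr
  have hcr : (r : ℝ) = c ^ 2 := (Real.sq_sqrt (by linarith)).symm
  have hc1 : 1.4 ≤ c := Real.le_sqrt_of_sq_le (by linarith)
  simp only
  rw [hcr] at h ⊢
  -- After multiplication by `k` and elimination of `A`, the left side is at least `(c² - 1/4) (k -
  -- c)² + c² / 4`.
  have h1 : 0 ≤ k * c ^ 2 + A - 2 * c ^ 3 + c / 2 := by
    refine nonneg_of_mul_nonneg_right ?_ (show 0 < k by linarith)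
    have : 0 ≤ (c ^ 2 - 1 / 4) * (k - c) ^ 2 := mul_nonneg (by nlinarith) (sq_nonneg _)
    nlinarith [sq_nonneg c]
  -- This is the slack in `U(r)`. The numerator is negative at `c = 1`, so `r = 1` needs a separate
  -- argument.
  have h2 : 0 < (4 * c ^ 4 - 1.25 * c ^ 3 - 3.75 * c ^ 2 - 0.75 * c - 0.25) / (c + 1) ^ 2 := by
    refine div_pos ?_ (by positivity)
    have a : 0 ≤ c ^ 3 * (c - 1.4) := mul_nonneg (by positivity) (by linarith)
    have b : 0 ≤ c ^ 2 * (c - 1.4) := mul_nonneg (by positivity) (by linarith)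
    have d : 0 ≤ c * (c - 1.4) := mul_nonneg (by positivity) (by linarith)
    linarith
  have h3 : 1 + (2 * c ^ 2 - 1) ^ 2 - ((c - 1) * (c ^ 2 - 1) + (2 * c ^ 2 - 1) * (c ^ 2 - 1) +
      (c - 1) * ((c ^ 2 / (c + 1) - 1) ^ 2 - 1 / 4)) =
      1 + 2 * c ^ 4 + c ^ 2 - 2 * c ^ 3 + c / 2 +
      (4 * c ^ 4 - 1.25 * c ^ 3 - 3.75 * c ^ 2 - 0.75 * c - 0.25) / (c + 1) ^ 2 := by
    have : c + 1 ≠ 0 := by positivity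
    field_simp
    ring
  rw [h3]
  linarith

theorem sphereBound_one : sphereBound 1 = 2 := by
  norm_num [sphereBound]

theorem card_wordBall_one_lt {r : ℕ} (hr : 2 ≤ r) {x : List ℕ} (hx : IsBalanced r x) :
    ((wordBall x 1).card : ℝ) < sphereBound r := by
  obtain ⟨k, A, hk, -, h, hW⟩ := exists_card_wordBall_one_le (by omega) hx
  refine lt_of_le_of_lt ?_ (lt_sphereBound hr (k := k) (A := A) (by exact_mod_cast hk)
    (by exact_mod_cast h))
  exact_mod_cast hW

theorem card_wordBall_one_le {r : ℕ} (hr : 0 < r) {x : List ℕ} (hx : IsBalanced r x) :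
    ((wordBall x 1).card : ℝ) ≤ sphereBound r := by
  rcases (show r = 1 ∨ 2 ≤ r by omega) with rfl | hr2
  · obtain ⟨k, A, hk, hA, h, hW⟩ := exists_card_wordBall_one_le hr hx
    -- Integrality is needed for `r = 1`: `k = 1` forces `A ≥ 1`.
    have : (wordBall x 1).card ≤ 2 := by
      push_cast at h hW
      rcases (show k = 1 ∨ 2 ≤ k by omega) with rfl | hk2 <;> omega
    rw [sphereBound_one]
    exact_mod_cast this
  · exact (card_wordBall_one_lt hr2 hx).le

theorem card_wordBall_le {r : ℕ} (hr : 0 < r) (t : ℕ) {x : List ℕ} (hx : IsBalanced r x) :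
    ((wordBall x t).card : ℝ) ≤ sphereBound r ^ t := by
  induction t generalizing x with
  | zero => simpa using card_wordBall_zero x
  | succ t ih =>
    have hU : 0 ≤ sphereBound r := (Nat.cast_nonneg _).trans (card_wordBall_one_le hr hx)
    calc ((wordBall x (t + 1)).card : ℝ)
        ≤ ∑ z ∈ wordBall x 1, ((wordBall z t).card : ℝ) := by
          exact_mod_cast (Finset.card_le_card (wordBall_succ_subset x t)).trans
            Finset.card_biUnion_le
      _ ≤ ∑ _z ∈ wordBall x 1, sphereBound r ^ t :=
          Finset.sum_le_sum fun z hz => ih (hx.perm (mem_wordBall.1 hz).1)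
      _ = (wordBall x 1).card * sphereBound r ^ t := by simp
      _ ≤ sphereBound r * sphereBound r ^ t :=
          mul_le_mul_of_nonneg_right (card_wordBall_one_le hr hx) (pow_nonneg hU t)
      _ = sphereBound r ^ (t + 1) := by ring

/-! ### Multipermutations as words -/

theorem exists_strictMono_of_permDist_le {n t : ℕ} {σ π : Equiv.Perm (Fin n)}
    (h : permDist σ π ≤ t) : ∃ (k : ℕ) (i j : Fin k → Fin n), n ≤ k + t ∧ StrictMono i ∧
      StrictMono j ∧ ∀ l, σ (i l) = π (j l) := by
  have hmem := Nat.sSup_mem (s := {k : ℕ | ∃ i j : Fin k → Fin n, StrictMono i ∧ StrictMono j ∧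
      ∀ l, σ (i l) = π (j l)})
    ⟨0, Fin.elim0, Fin.elim0, fun a => a.elim0, fun a => a.elim0, fun a => a.elim0⟩
    ⟨n, fun k ⟨i, _, hi, _⟩ => by simpa using Fintype.card_le_of_injective i hi.injective⟩
  obtain ⟨i, j, hi, hj, hij⟩ := hmem
  refine ⟨_, i, j, ?_, hi, hj, hij⟩
  unfold permDist lcsLength at h
  omega

theorem ofFn_comp_sublist {α : Type*} {n k : ℕ} (x : Fin n → α) {i : Fin k → Fin n}
    (hi : StrictMono i) : (List.ofFn fun l => x (i l)).Sublist (List.ofFn x) := by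
  rw [List.sublist_iff_exists_fin_orderEmbedding_get_eq]
  refine ⟨OrderEmbedding.ofStrictMono (fun l => (i (l.cast (by simp))).cast (by simp))
    fun a b hab => ?_, fun l => ?_⟩
  · exact hi (show a.cast _ < b.cast _ from hab)
  · simp
    rfl

theorem exists_permDist_le {n r t : ℕ} {x y : Fin n → ℕ} (hx : x ∈ multiperms n r)
    (hy : y ∈ multiperms n r) (h : ulamDist r x y ≤ t) :
    ∃ σ π : Equiv.Perm (Fin n), multiperm r σ = x ∧ multiperm r π = y ∧ permDist σ π ≤ t := by
  obtain ⟨σ, hσ⟩ := hx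
  obtain ⟨π, hπ⟩ := hy
  obtain ⟨σ', π', h1, h2, h3⟩ := Nat.sInf_mem (s := {k : ℕ | ∃ σ π : Equiv.Perm (Fin n),
    multiperm r σ = x ∧ multiperm r π = y ∧ permDist σ π = k}) ⟨_, σ, π, hσ, hπ, rfl⟩
  exact ⟨σ', π', h1, h2, h3.le.trans h⟩

theorem ofFn_multiperm_perm {n : ℕ} (r : ℕ) (σ : Equiv.Perm (Fin n)) :
    (List.ofFn (multiperm r σ)).Perm (List.ofFn fun v : Fin n => (v : ℕ) / r + 1) :=
  Equiv.Perm.ofFn_comp_perm σ fun v : Fin n => (v : ℕ) / r + 1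

/-- Equal values of the representing permutations give equal letters, so a common subsequence
survives the passage to words. -/
theorem ofFn_mem_wordBall {n r t : ℕ} {x y : Fin n → ℕ} (hx : x ∈ multiperms n r)
    (hy : y ∈ sphere r x t) : List.ofFn y ∈ wordBall (List.ofFn x) t := by
  obtain ⟨σ, π, rfl, rfl, h⟩ := exists_permDist_le hx hy.1 hy.2
  obtain ⟨k, i, j, hk, hi, hj, hij⟩ := exists_strictMono_of_permDist_le h
  refine mem_wordBall.2 ⟨(ofFn_multiperm_perm r π).trans (ofFn_multiperm_perm r σ).symm,
    List.ofFn fun l => multiperm r σ (i l), ofFn_comp_sublist _ hi, ?_, by simpa using hk⟩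
  have : (fun l => multiperm r σ (i l)) = fun l => multiperm r π (j l) := by
    funext l
    simp only [multiperm, hij l]
  rw [this]
  exact ofFn_comp_sublist _ hj

theorem ncard_sphere_le_card_wordBall {n r : ℕ} (t : ℕ) {x : Fin n → ℕ}
    (hx : x ∈ multiperms n r) : (sphere r x t).ncard ≤ (wordBall (List.ofFn x) t).card := by
  rw [← Set.ncard_coe_finset]
  exact Set.ncard_le_ncard_of_injOn List.ofFn (fun y hy => ofFn_mem_wordBall hx hy)
    (List.ofFn_injective.injOn) (Finset.finite_toSet _)

theorem isBalanced_ofFn {r : ℕ} {x : Fin (2 * r) → ℕ} (hx : x ∈ multiperms (2 * r) r) :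
    IsBalanced r (List.ofFn x) := by
  obtain ⟨σ, rfl⟩ := hx
  refine IsBalanced.perm ⟨by simp, ?_, ?_⟩ (ofFn_multiperm_perm r σ)
  · intro a ha
    obtain ⟨v, rfl⟩ := List.mem_ofFn.1 ha
    have : (v : ℕ) / r < 2 := Nat.div_lt_of_lt_mul (v.2.trans_eq (mul_comm 2 r))
    generalize (v : ℕ) / r = a at this ⊢
    omega
  · rw [List.map_ofFn, List.sum_ofFn]
    have h := Fin.sum_univ_eq_sum_range (fun v => if v / r + 1 = 1 then (1 : ℤ) else -1) (2 * r)
    refine Eq.trans (Finset.sum_congr rfl fun v _ => rfl) (h.trans ?_)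
    rw [two_mul, Finset.sum_range_add]
    have h1 : ∀ v ∈ Finset.range r, (if v / r + 1 = 1 then (1 : ℤ) else -1) = 1 := fun v hv => by
      simp [Nat.div_eq_of_lt (Finset.mem_range.1 hv)]
    have h2 : ∀ v ∈ Finset.range r, (if (r + v) / r + 1 = 1 then (1 : ℤ) else -1) = -1 :=
      fun v hv => by
        have hr : 0 < r := (Nat.zero_le v).trans_lt (Finset.mem_range.1 hv)
        simp [Nat.add_div_left v hr]
    rw [Finset.sum_congr rfl h1, Finset.sum_congr rfl h2]
    simp

/-! ### Covering bound and maximal codes -/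

theorem finite_multiperms (n r : ℕ) : (multiperms n r).Finite := Set.finite_range _

/-- Every `r`-set of positions is the set of ones of some multipermutation: extend a bijection onto
the `r` smallest values to a permutation. -/
theorem choose_le_ncard_multiperms (r : ℕ) (hr : 0 < r) :
    (2 * r).choose r ≤ (multiperms (2 * r) r).ncard := by
  classical
  have hlow : Fintype.card {v : Fin (2 * r) // (v : ℕ) < r} = r := by
    rw [Fintype.card_subtype, Fin.card_filter_val_lt]
    omega
  have hex : ∀ P ∈ Finset.powersetCard r (Finset.univ : Finset (Fin (2 * r))),
      ∃ σ : Equiv.Perm (Fin (2 * r)), ∀ i, i ∈ P ↔ multiperm r σ i = 1 := by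
    intro P hP
    have f : {i // i ∈ P} ≃ {v : Fin (2 * r) // (v : ℕ) < r} := Fintype.equivOfCardEq (by
      rw [hlow, Fintype.card_coe, (Finset.mem_powersetCard.1 hP).2])
    refine ⟨f.extendSubtype, fun i => ?_⟩
    have hone : multiperm r f.extendSubtype i = 1 ↔ (f.extendSubtype i : ℕ) < r := by
      simp only [multiperm, Nat.add_eq_right, Nat.div_eq_zero_iff]
      omega
    rw [hone]
    exact ⟨f.extendSubtype_mem i, fun h => by_contra fun hi => f.extendSubtype_not_mem i hi h⟩
  choose! s hs using hex
  have h := Set.ncard_le_ncard_of_injOn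
    (s := (Finset.powersetCard r (Finset.univ : Finset (Fin (2 * r))) : Set _))
    (t := multiperms (2 * r) r)
    (fun P => multiperm r (s P)) (fun P _ => Set.mem_range_self _)
    (fun P hP Q hQ hPQ => Finset.ext fun i => by
      rw [hs P hP, hs Q hQ]; simp only at hPQ; rw [hPQ]) (finite_multiperms _ _)
  rwa [Set.ncard_coe_finset, Finset.card_powersetCard, Finset.card_univ, Fintype.card_fin] at h

theorem ncard_sphere_le {r : ℕ} (hr : 0 < r) (t : ℕ) {x : Fin (2 * r) → ℕ}
    (hx : x ∈ multiperms (2 * r) r) : ((sphere r x t).ncard : ℝ) ≤ sphereBound r ^ t :=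
  (Nat.cast_le.2 (ncard_sphere_le_card_wordBall t hx)).trans
    (card_wordBall_le hr t (isBalanced_ofFn hx))

theorem ncard_sphere_one_lt {r : ℕ} (hr : 2 ≤ r) {x : Fin (2 * r) → ℕ}
    (hx : x ∈ multiperms (2 * r) r) : ((sphere r x 1).ncard : ℝ) < sphereBound r :=
  (Nat.cast_le.2 (ncard_sphere_le_card_wordBall 1 hx)).trans_lt
    (card_wordBall_one_lt hr (isBalanced_ofFn hx))

theorem sphereBound_pos {r : ℕ} (hr : 0 < r) : 0 < sphereBound r := by
  rcases (show r = 1 ∨ 2 ≤ r by omega) with rfl | hr2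
  · rw [sphereBound_one]; norm_num
  · exact (Nat.cast_nonneg _).trans_lt
      (ncard_sphere_one_lt hr2 (Set.mem_range_self (Equiv.refl (Fin (2 * r)))))

/-- The covering bound. -/
theorem le_ncard_of_covering {r : ℕ} (hr : 0 < r) (t : ℕ) {C : Set (Fin (2 * r) → ℕ)}
    (hC : IsMPC r C) (hcov : ∀ x ∈ multiperms (2 * r) r, ∃ c ∈ C, x ∈ sphere r c t) :
    ((2 * r).factorial : ℝ) / ((r.factorial : ℝ) ^ 2 * sphereBound r ^ t) ≤ C.ncard := by
  classical
  have hfin : C.Finite := (finite_multiperms _ _).subset hC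
  have hU := pow_pos (sphereBound_pos hr) t
  have hsub : multiperms (2 * r) r ⊆ ⋃ c ∈ hfin.toFinset, sphere r c t := by
    intro x hx
    obtain ⟨c, hc, hxc⟩ := hcov x hx
    exact Set.mem_iUnion₂.2 ⟨c, hfin.mem_toFinset.2 hc, hxc⟩
  have hfinU : (⋃ c ∈ hfin.toFinset, sphere r c t).Finite :=
    (finite_multiperms (2 * r) r).subset (Set.iUnion₂_subset fun c _ x hx => hx.1)
  have h1 : ((2 * r).choose r : ℝ) ≤ C.ncard * sphereBound r ^ t := by
    calc ((2 * r).choose r : ℝ) ≤ ∑ c ∈ hfin.toFinset, ((sphere r c t).ncard : ℝ) := by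
          exact_mod_cast (choose_le_ncard_multiperms r hr).trans
            ((Set.ncard_le_ncard hsub hfinU).trans (Finset.set_ncard_biUnion_le _ _))
      _ ≤ ∑ _c ∈ hfin.toFinset, sphereBound r ^ t :=
          Finset.sum_le_sum fun c hc => ncard_sphere_le hr t (hC (hfin.mem_toFinset.1 hc))
      _ = C.ncard * sphereBound r ^ t := by
          rw [Finset.sum_const, nsmul_eq_mul, Set.ncard_eq_toFinset_card C hfin]
  have h2 : ((2 * r).factorial : ℝ) = (2 * r).choose r * (r.factorial : ℝ) ^ 2 := by
    have := Nat.choose_mul_factorial_mul_factorial (show r ≤ 2 * r by omega)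
    rw [show 2 * r - r = r by omega] at this
    rw [← this]
    push_cast
    ring
  rw [div_le_iff₀ (by positivity), h2]
  calc ((2 * r).choose r : ℝ) * (r.factorial : ℝ) ^ 2
      ≤ (C.ncard * sphereBound r ^ t) * (r.factorial : ℝ) ^ 2 :=
        mul_le_mul_of_nonneg_right h1 (by positivity)
    _ = C.ncard * ((r.factorial : ℝ) ^ 2 * sphereBound r ^ t) := by ring

theorem permDist_comm {n : ℕ} (σ π : Equiv.Perm (Fin n)) : permDist σ π = permDist π σ := by
  unfold permDist lcsLength
  congr 3
  ext k
  constructor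
  · rintro ⟨i, j, hi, hj, h⟩
    exact ⟨j, i, hj, hi, fun l => (h l).symm⟩
  · rintro ⟨i, j, hi, hj, h⟩
    exact ⟨j, i, hj, hi, fun l => (h l).symm⟩

theorem ulamDist_comm {n : ℕ} (r : ℕ) (x y : Fin n → ℕ) : ulamDist r x y = ulamDist r y x := by
  unfold ulamDist
  congr 1
  ext k
  constructor
  · rintro ⟨σ, π, h1, h2, h3⟩
    exact ⟨π, σ, h2, h1, (permDist_comm π σ).trans h3⟩
  · rintro ⟨σ, π, h1, h2, h3⟩
    exact ⟨π, σ, h2, h1, (permDist_comm π σ).trans h3⟩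

theorem permDist_self {n : ℕ} (σ : Equiv.Perm (Fin n)) : permDist σ σ = 0 := by
  unfold permDist lcsLength
  rw [Nat.sub_eq_zero_iff_le]
  exact le_csSup ⟨n, fun k ⟨i, _, hi, _⟩ => by simpa using Fintype.card_le_of_injective i hi.injective⟩
    ⟨id, id, strictMono_id, strictMono_id, fun _ => rfl⟩

theorem ulamDist_self {n r : ℕ} {x : Fin n → ℕ} (hx : x ∈ multiperms n r) :
    ulamDist r x x = 0 := by
  obtain ⟨σ, rfl⟩ := hx
  exact Nat.sInf_eq_zero.2 (Or.inl ⟨σ, σ, rfl, rfl, permDist_self σ⟩)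

theorem eq_of_ulamDist_eq_zero {n r : ℕ} {x y : Fin n → ℕ} (hx : x ∈ multiperms n r)
    (hy : y ∈ multiperms n r) (h : ulamDist r x y = 0) : x = y := by
  obtain ⟨-, l, h1, h2, h3⟩ :=
    mem_wordBall.1 (ofFn_mem_wordBall (t := 0) hx (show y ∈ sphere r x 0 from ⟨hy, h.le⟩))
  refine List.ofFn_injective ((h1.eq_of_length_le h3).symm.trans (h2.eq_of_length_le ?_))
  simpa using h3

/-- A code of maximal size with minimum distance `d` has covering radius at most `d - 1`. -/
theorem covering_of_maximal {n r d : ℕ} {C : Set (Fin n → ℕ)} (hC : IsMPCDist r d C)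
    (hmax : ∀ C' : Set (Fin n → ℕ), IsMPCDist r d C' → C'.ncard ≤ C.ncard) :
    ∀ x ∈ multiperms n r, ∃ c ∈ C, x ∈ sphere r c (d - 1) := by
  intro x hx
  obtain ⟨hM, ⟨a, ha, b, hb, hab, hd⟩, hlow⟩ := hC
  have hdpos : 0 < d := by
    rcases Nat.eq_zero_or_pos d with h | h
    · exact absurd (eq_of_ulamDist_eq_zero (hM ha) (hM hb) (hd.trans h)) hab
    · exact h
  by_contra hcon
  push Not at hcon
  have hfar : ∀ c ∈ C, d ≤ ulamDist r c x := fun c hc => by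
    by_contra hlt
    exact hcon c hc ⟨hx, by omega⟩
  have hxC : x ∉ C := fun h => by
    have := hfar x h
    rw [ulamDist_self hx] at this
    omega
  -- Adjoining the uncovered `x` keeps the minimum distance exactly `d`, still attained by `a` and
  -- `b`, which contradicts maximality.
  have hle := hmax (insert x C) ⟨Set.insert_subset hx hM,
    ⟨a, Set.mem_insert_of_mem _ ha, b, Set.mem_insert_of_mem _ hb, hab, hd⟩, by
      rintro k ⟨y, hy, z, hz, hyz, rfl⟩
      rcases hy with rfl | hy <;> rcases hz with rfl | hz
      · exact absurd rfl hyz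
      · rw [ulamDist_comm]; exact hfar z hz
      · exact hfar y hy
      · exact hlow ⟨y, hy, z, hz, hyz, rfl⟩⟩
  rw [Set.ncard_insert_of_notMem hxC ((finite_multiperms n r).subset hM)] at hle
  omega

end UlamCode

theorem mainTheorem12 (n r : ℕ) (hr : 0 < r) (hn : n = 2 * r) :
    (∀ σ : Equiv.Perm (Fin n),
      ((UlamCode.sphere r (UlamCode.multiperm r σ) 1).ncard : ℝ) ≤ UlamCode.sphereBound r ∧
      (2 ≤ r →
        ((UlamCode.sphere r (UlamCode.multiperm r σ) 1).ncard : ℝ) < UlamCode.sphereBound r)) ∧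
    (∀ C : Set (Fin n → ℕ), UlamCode.IsPerfect r 1 C →
      (n.factorial : ℝ) / ((r.factorial : ℝ) ^ 2 * UlamCode.sphereBound r) ≤ (C.ncard : ℝ)) ∧
    (∀ (d : ℕ) (C : Set (Fin n → ℕ)), UlamCode.IsMPCDist r d C →
      (∀ C' : Set (Fin n → ℕ), UlamCode.IsMPCDist r d C' → C'.ncard ≤ C.ncard) →
      (n.factorial : ℝ) / ((r.factorial : ℝ) ^ 2 * UlamCode.sphereBound r ^ (d - 1)) ≤
        (C.ncard : ℝ)) := by
  subst hn
  refine ⟨fun σ => ⟨?_, fun hr2 => UlamCode.ncard_sphere_one_lt hr2 (Set.mem_range_self σ)⟩,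
    fun C hC => ?_, fun d C hC hmax =>
      UlamCode.le_ncard_of_covering hr (d - 1) hC.1 (UlamCode.covering_of_maximal hC hmax)⟩
  · simpa using UlamCode.ncard_sphere_le hr 1 (Set.mem_range_self σ)
  · simpa using UlamCode.le_ncard_of_covering hr 1 hC.1 fun x hx => (hC.2 x hx).exists
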